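/- Let a transmitter use, over $n\ge 1$ channel uses, a memoryless channel to a receiver with transition densities $p_{Y|X}(y|x)$ and a memoryless channel to a detector with transition densities $p_{W|X}(w|x)$ (densities with respect to $\sigma$-finite reference measures $dy$, $dw$ on the output alphabets, e.g. Lebesgue or counting measure). Let $x_0$ be the innocent symbol, i.e. the channel input when nothing is sent, and let $p_{\tilde X}$ be an arbitrary probability law (the kernel) on the input alphabet. Write $p_{\tilde W}(w)=\int p_{\tilde X}(x)\,p_{W|X}(w|x)\,dx$, $\chi^2=\chi^2(p_{\tilde W}\,\|\,p_{W|X=x_0})=\int \frac{(p_{\tilde W}(w)-p_{W|X}(w|x_0))^2}{p_{W|X}(w|x_0)}\,dw$ and assume $0<\chi^2<\infty$. Let $0<\epsilon_{\rm det}<1$, $0<\epsilon_{\rm dec}<1$, and $\xi=e^{-\frac12 \mathsf W_0(4\epsilon_{\rm det}^2)}$, where $\mathsf W_0$ is the principal branch of the Lambert function. Let the transmitter use the sparse signalling law $$p_X=(1-\tau)\,\delta_{x_0}+\tau\,p_{\tilde X},\qquad \tau=\frac{2\,\xi\,\epsilon_{\rm det}}{\sqrt{n\,\chi^2}},$$ and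 assume $\tau\le 1$. Then there is an integer $M\ge 1$ such that for a random codebook of $M$ words of length $n$ whose symbols are drawn i.i.d. from $p_X$: (i) with positive probability the codebook admits a decoder whose decoding error probability, averaged over equally likely messages, is at most $\epsilon_{\rm dec}$ (in particular, such a code exists); (ii) the probability of detection is at most $\epsilon_{\rm det}$, i.e. $\alpha+\beta\ge 1-\epsilon_{\rm det}$ for every (possibly randomized) test of a detector that knows $p_X$ but not the codebook. Here $\alpha$ is the probability of deciding that a message was sent when the input is $(x_0,\dots,x_0)$, and $\beta$ is the probability of deciding that none was sent when a uniformly chosen word of the random codebook is sent; (iii) for every $0<\rho\le 1$, $$\log_2 M\ \ge\ \epsilon_{\rm det}\sqrt n\,L(\rho)+\frac1\rho\log_2\epsilon_{\rm dec},\qquad L(\rho)=\frac{2\xi}{\log 2}\Big(\frac{1+\rho}{\rho}\Big)\frac{1-e^{-\frac1{1+\rho}\mathcal E_0(\rho)}}{\sqrt{\chi^2}},$$ where $\log$ is the natural logarithm and $$\mathcal E_0(\rho)=-\log\int\Big(\int p_{\tilde X}(x)\,p_{Y|X}(y|x)^{\frac1{1+\rho}}\,dx\Big)^{1+\rho}dy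 .$$ -/

import Mathlib

open MeasureTheory
open scoped ENNReal NNReal

noncomputable section

namespace LPD

/-- The principal branch of the Lambert function: for `z ≥ -1/e`, the unique `w ≥ -1`
with `w * exp w = z`. -/
def lambertW0 (z : ℝ) : ℝ :=
  Function.invFunOn (fun w : ℝ => w * Real.exp w) (Set.Ici (-1)) z

/-- `ξ = exp (-W₀(4 ε²) / 2)`. -/
def xi (εdet : ℝ) : ℝ :=
  Real.exp (-(1 / 2) * lambertW0 (4 * εdet ^ 2))

/-- A channel from `𝒳` to `𝒴` given by transition densities `p(y|x)` with respect to a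
reference measure `ν` on the output space (Lebesgue measure for continuous outputs, counting
measure for discrete ones). -/
structure DensityChannel (𝒳 : Type*) {𝒴 : Type*} [MeasurableSpace 𝒳] [MeasurableSpace 𝒴]
    (ν : Measure 𝒴) where
  density : 𝒳 → 𝒴 → ℝ≥0
  measurable_density : Measurable (Function.uncurry density)
  lintegral_density : ∀ x, ∫⁻ y, (density x y : ℝ≥0∞) ∂ν = 1

section

variable {𝒳 𝒴 𝒲 : Type*} [MeasurableSpace 𝒳] [MeasurableSpace 𝒴] [MeasurableSpace 𝒲]

/-- Law of the output block when the word `x` is sent over `n` memoryless uses of the channel: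
it has the density `∏ i, p(y i | x i)`. -/
def DensityChannel.blockLaw {ν : Measure 𝒴} (K : DensityChannel 𝒳 ν) {n : ℕ}
    (x : Fin n → 𝒳) : Measure (Fin n → 𝒴) :=
  (Measure.pi fun _ : Fin n => ν).withDensity fun y => ∏ i, (K.density (x i) (y i) : ℝ≥0∞)

/-- Density of the channel output when the input has law `P`. -/
def DensityChannel.outputDensity {ν : Measure 𝒴} (K : DensityChannel 𝒳 ν) (P : Measure 𝒳)
    (y : 𝒴) : ℝ≥0∞ :=
  ∫⁻ x, (K.density x y : ℝ≥0∞) ∂P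

/-- Gallager's function `E₀(ρ, P, p)`, with the natural logarithm. For `ρ ≥ 0` and a probability
measure `P` the outer integral lies in `(0, 1]`. -/
def DensityChannel.gallagerE0 {ν : Measure 𝒴} (K : DensityChannel 𝒳 ν) (ρ : ℝ)
    (P : Measure 𝒳) : ℝ :=
  -Real.log
    (∫⁻ y, (∫⁻ x, (K.density x y : ℝ≥0∞) ^ (1 / (1 + ρ)) ∂P) ^ (1 + ρ) ∂ν).toReal

/-- Chi-squared distance `∫ (p - q)² / q` of two densities with respect to `μ`. The quotient is
taken in `[0, ∞]`, so it is `0` where `p = q = 0` and `∞` where `q = 0 ≠ p`. -/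
def chiSq (μ : Measure 𝒲) (p q : 𝒲 → ℝ≥0∞) : ℝ≥0∞ :=
  ∫⁻ w, ENNReal.ofReal (((p w).toReal - (q w).toReal) ^ 2) / q w ∂μ

/-- `χ²(p_W̃ ‖ p_{W|X=x₀})`: the chi-squared distance between the output density induced by the
kernel law `P` and the output density under the innocent symbol `x₀`. -/
def DensityChannel.kernelChiSq {μ : Measure 𝒲} (D : DensityChannel 𝒳 μ) (x₀ : 𝒳)
    (P : Measure 𝒳) : ℝ≥0∞ :=
  chiSq μ (D.outputDensity P) fun w => (D.density x₀ w : ℝ≥0∞)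

/-- Sparse signalling law `(1 - τ) δ_{x₀} + τ P`. -/
def sparseLaw (τ : ℝ) (x₀ : 𝒳) (P : Measure 𝒳) : Measure 𝒳 :=
  ENNReal.ofReal (1 - τ) • Measure.dirac x₀ + ENNReal.ofReal τ • P

/-- Law of a random codebook of `M` words of length `n`, all symbols being i.i.d. with law `PX`. -/
def codebookLaw (PX : Measure 𝒳) (M n : ℕ) : Measure (Fin M → Fin n → 𝒳) :=
  Measure.pi fun _ => Measure.pi fun _ => PX

/-- Probability of decoding error of the code with codebook `c` and decoder `dec`, averaged over
equally likely messages. -/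
def DensityChannel.avgDecodingError {ν : Measure 𝒴} (K : DensityChannel 𝒳 ν) {M n : ℕ}
    (c : Fin M → Fin n → 𝒳) (dec : (Fin n → 𝒴) → Fin M) : ℝ≥0∞ :=
  (M : ℝ≥0∞)⁻¹ * ∑ m, K.blockLaw (c m) {y | dec y ≠ m}

/-- False detection probability `α` of the (possibly randomized) test which, on observing `w`,
decides with probability `φ w` that a message was sent: the innocent word `(x₀, …, x₀)` is the
channel input. -/
def DensityChannel.falseDetection {μ : Measure 𝒲} (D : DensityChannel 𝒳 μ) (x₀ : 𝒳) {n : ℕ}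
    (φ : (Fin n → 𝒲) → ℝ≥0∞) : ℝ≥0∞ :=
  ∫⁻ w, φ w ∂D.blockLaw fun _ : Fin n => x₀

/-- Miss detection probability `β` of the test `φ`: an equally likely message is sent with a
codebook that is unknown to the detector and drawn from `codebookLaw PX M n`. -/
def DensityChannel.missDetection {μ : Measure 𝒲} (D : DensityChannel 𝒳 μ) (PX : Measure 𝒳)
    (M : ℕ) {n : ℕ} (φ : (Fin n → 𝒲) → ℝ≥0∞) : ℝ≥0∞ :=
  ∫⁻ c : Fin M → Fin n → 𝒳,
    (M : ℝ≥0∞)⁻¹ * ∑ m, ∫⁻ w, (1 - φ w) ∂D.blockLaw (c m) ∂codebookLaw PX M n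

/-- Probability of detection: `1 - min (α + β)` over all tests of the detector. -/
def DensityChannel.detectionProb {μ : Measure 𝒲} (D : DensityChannel 𝒳 μ) (x₀ : 𝒳)
    (PX : Measure 𝒳) (M n : ℕ) : ℝ≥0∞ :=
  1 - ⨅ (φ : (Fin n → 𝒲) → ℝ≥0∞) (_ : Measurable φ) (_ : ∀ w, φ w ≤ 1),
    (D.falseDetection x₀ φ + D.missDetection PX M φ)

/-- The coefficient `L(ρ)` of `ε_det √n`, for the receiver's channel `K`, the detector's channel
`D`, the innocent symbol `x₀` and the kernel law `P`. -/
def coeffL {ν : Measure 𝒴} {μ : Measure 𝒲} (K : DensityChannel 𝒳 ν) (D : DensityChannel 𝒳 μ)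
    (x₀ : 𝒳) (P : Measure 𝒳) (εdet ρ : ℝ) : ℝ :=
  2 * xi εdet / Real.log 2 * ((1 + ρ) / ρ) *
    ((1 - Real.exp (-(1 / (1 + ρ)) * K.gallagerE0 ρ P)) / √(D.kernelChiSq x₀ P).toReal)

end

end LPD

end

namespace LPD

/-! ### Product integrals, Jensen's inequality and binary hypothesis testing -/

section General

variable {α : Type*} [MeasurableSpace α]

/-! Detection: averaged over the unknown codebook, the detector sees i.i.d. outputs, whatever `M`
is. The likelihood ratio to the innocent output has second moment at most `(1 + τ²χ²)^n ≤ exp(nτ²χ²)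
= exp(4ξ²ε_det²)`, and `ξ` is tuned so that this is at most `1 + 4ε_det²` (`exp_four_mul_xi_sq_le`).
`one_le_test_errors_add` turns this into a bound on every test.

Decoding: Gallager's random coding bound (`codebookLaw_exists_decoder_pos`) gives error at most
`(M-1)^ρ G^n`, with `G` Gallager's integral for the sparse law. Minkowski's inequality and `1 + x ≤
e^x` bound `G` by `exp(-τ(1+ρ)(1 - e^(-E₀/(1+ρ))))` (`gallagerIntegral_sparseLaw_le_exp`).

One `M` must serve every `ρ`: take the least natural number above all the numbers `2^R(ρ)`, `R(ρ)`
being the claimed lower bound. By minimality `M-1 < 2^R(ρ)` for some `ρ`, and the bound at that `ρ`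
yields the decoder. Such an `M` exists because `E₀(ρ) → 0` as `ρ → 0`, so the term `log ε_dec < 0`
wins there (`exists_nat_rpow_le`). -/

theorem lintegral_pi_prod (m : Measure α) [SigmaFinite m] {n : ℕ} (f : Fin n → α → ℝ≥0∞)
    (hf : ∀ i, Measurable (f i)) :
    ∫⁻ x, ∏ i, f i (x i) ∂(Measure.pi fun _ : Fin n => m) = ∏ i, ∫⁻ x, f i x ∂m := by
  induction n with
  | zero => simp
  | succ n ih =>
    have h := (measurePreserving_piFinSuccAbove (fun _ : Fin (n + 1) => m) 0)
    have hg : Measurable fun z : α × (Fin n → α) => f 0 z.1 * ∏ i, f i.succ (z.2 i) := by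
      have := hf
      fun_prop
    have h2 := h.lintegral_comp hg
    simp only [MeasurableEquiv.piFinSuccAbove_apply, Fin.insertNthEquiv_zero,
      Fin.consEquiv_symm_apply] at h2
    simp only [Fin.prod_univ_succ]
    rw [← ih (fun i => f i.succ) fun i => hf _,
      ← lintegral_prod_mul (hf 0).aemeasurable (Finset.aemeasurable_fun_prod _ fun i _ =>
        ((hf i.succ).comp (measurable_pi_apply i)).aemeasurable)]
    exact h2

theorem lintegral_rpow_le_rpow_lintegral (m : Measure α) [IsProbabilityMeasure m]
    {ρ : ℝ} (h0 : 0 < ρ) (h1 : ρ ≤ 1) {f : α → ℝ≥0∞} (hf : Measurable f) :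
    ∫⁻ x, f x ^ ρ ∂m ≤ (∫⁻ x, f x ∂m) ^ ρ := by
  have h := eLpNorm'_le_eLpNorm'_of_exponent_le h0 h1 m hf.aestronglyMeasurable
  simp only [eLpNorm', enorm_eq_self, ENNReal.rpow_one, div_one] at h
  have := ENNReal.rpow_le_rpow h h0.le
  rwa [← ENNReal.rpow_mul, one_div_mul_cancel h0.ne', ENNReal.rpow_one] at this

theorem exists_measurable_argmax {N : ℕ} (f : Fin (N + 1) → α → ℝ≥0∞)
    (hf : ∀ i, Measurable (f i)) :
    ∃ d : α → Fin (N + 1), Measurable d ∧ ∀ a i, f i a ≤ f (d a) a := by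
  induction N with
  | zero => exact ⟨fun _ => 0, measurable_const, fun a i => by rw [Fin.fin_one_eq_zero i]⟩
  | succ N ih =>
    obtain ⟨d, hd, h⟩ := ih (fun i => f i.castSucc) fun i => hf _
    have hm : Measurable fun a => f (d a).castSucc a := by
      have : Measurable (Function.uncurry fun (a : α) (i : Fin (N + 1)) => f i.castSucc a) :=
        measurable_from_prod_countable_left fun i => hf i.castSucc
      exact this.comp (measurable_id.prodMk hd)
    classical
    refine ⟨fun a => if f (d a).castSucc a ≤ f (Fin.last _) a then Fin.last _ else (d a).castSucc,
      Measurable.ite (measurableSet_le hm (hf _)) measurable_const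
        ((measurable_of_countable _).comp hd), fun a i => ?_⟩
    dsimp only
    split_ifs with hc
    · refine Fin.lastCases le_rfl (fun j => (h a j).trans hc) i
    · refine Fin.lastCases (not_le.1 hc).le (fun j => h a j) i

/-- A subtraction-free form of `4e(1-2φ)(p-q) ≤ 4e|q-p| ≤ 4e²p + (q-p)²/p`, the last step being
`(|q-p| - 2ep)² ≥ 0`. Integrated, it plays the role of Cauchy–Schwarz between total variation and
chi-squared. -/
theorem test_pointwise {e : ℝ} (he : 0 < e) (p q φ : ℝ≥0∞) (hφ : φ ≤ 1) :
    ENNReal.ofReal (4 * e) * p + ENNReal.ofReal (4 * e + 2) * q ≤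
      ENNReal.ofReal (8 * e) * (φ * p + (1 - φ) * q) + ENNReal.ofReal (4 * e ^ 2 + 1) * p
        + q ^ 2 / p := by
  have hc : ENNReal.ofReal (4 * e ^ 2 + 1) ≠ 0 := by
    simp only [ne_eq, ENNReal.ofReal_eq_zero, not_le]; positivity
  rcases eq_or_ne p ∞ with rfl | hp
  · simp [ENNReal.mul_top hc]
  rcases eq_or_ne q 0 with rfl | hq0
  · rcases eq_or_ne p 0 with rfl | hp0
    · simp
    · have : ENNReal.ofReal (4 * e) ≤ ENNReal.ofReal (4 * e ^ 2 + 1) :=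
        ENNReal.ofReal_le_ofReal (by nlinarith [sq_nonneg (2 * e - 1)])
      simp only [mul_zero, add_zero]
      exact le_add_right (le_add_left (by gcongr))
  rcases eq_or_ne p 0 with rfl | hp0
  · rw [ENNReal.div_zero (by simpa using hq0)]; simp
  rcases eq_or_ne q ∞ with rfl | hq
  · rw [ENNReal.top_pow two_ne_zero, ENNReal.top_div_of_ne_top hp]; simp
  lift p to ℝ≥0 using hp
  lift q to ℝ≥0 using hq
  lift φ to ℝ≥0 using ne_top_of_le_ne_top ENNReal.one_ne_top hφ
  have hφ' : φ ≤ 1 := by exact_mod_cast hφ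
  have hp' : p ≠ 0 := by simpa using hp0
  have hpp : (0 : ℝ) < p := by positivity
  rw [ENNReal.ofReal, ENNReal.ofReal, ENNReal.ofReal, ENNReal.ofReal, ← ENNReal.coe_pow,
    ← ENNReal.coe_div hp']
  norm_cast
  rw [← NNReal.coe_le_coe]
  push_cast [NNReal.coe_sub hφ']
  rw [Real.coe_toNNReal _ (by positivity), Real.coe_toNNReal _ (by positivity),
    Real.coe_toNNReal _ (by positivity), Real.coe_toNNReal _ (by positivity)]
  have hφ0 : (0 : ℝ) ≤ φ := φ.2
  have hφ1 : (φ : ℝ) ≤ 1 := by exact_mod_cast hφ'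
  have key : (q : ℝ) ^ 2 / p = ((q : ℝ) - p) ^ 2 / p + 2 * q - p := by field_simp; ring
  have key2 : 4 * e * |(q : ℝ) - p| ≤ 4 * e ^ 2 * p + ((q : ℝ) - p) ^ 2 / p := by
    have : 4 * e ^ 2 * p + ((q : ℝ) - p) ^ 2 / p - 4 * e * |(q : ℝ) - p|
        = (|(q : ℝ) - p| - 2 * e * p) ^ 2 / p := by
      field_simp; linear_combination -(sq_abs ((q : ℝ) - p))
    have h2 : 0 ≤ (|(q : ℝ) - p| - 2 * e * p) ^ 2 / p := by positivity
    linarith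
  rw [key]
  have key3 : (1 - 2 * (φ : ℝ)) * (p - q) ≤ |(q : ℝ) - p| := by
    rw [abs_sub_comm]
    calc _ ≤ |(1 - 2 * (φ : ℝ)) * (p - q)| := le_abs_self _
      _ = |1 - 2 * (φ : ℝ)| * |(p : ℝ) - q| := abs_mul _ _
      _ ≤ 1 * |(p : ℝ) - q| := by
        gcongr
        rw [abs_le]; constructor <;> linarith
      _ = _ := one_mul _
  nlinarith [mul_le_mul_of_nonneg_left key3 (by positivity : 0 ≤ 4 * e)]

/-- Any test between two laws whose likelihood ratio has second moment at most `1 + 4 e ^ 2` has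
error probabilities with sum at least `1 - e`. -/
theorem one_le_test_errors_add (m : Measure α) {e : ℝ} (he : 0 < e) {p q φ : α → ℝ≥0∞}
    (hp : Measurable p) (hq : Measurable q) (hφm : Measurable φ) (hφ : ∀ x, φ x ≤ 1)
    (hp1 : ∫⁻ x, p x ∂m = 1) (hq1 : ∫⁻ x, q x ∂m = 1)
    (h : ∫⁻ x, q x ^ 2 / p x ∂m ≤ ENNReal.ofReal (1 + 4 * e ^ 2)) :
    1 ≤ (∫⁻ x, φ x * p x ∂m) + (∫⁻ x, (1 - φ x) * q x ∂m) + ENNReal.ofReal e := by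
  have h1 : ∫⁻ x, (ENNReal.ofReal (4 * e) * p x + ENNReal.ofReal (4 * e + 2) * q x) ∂m ≤ _ :=
    lintegral_mono fun x => test_pointwise he (p x) (q x) (φ x) (hφ x)
  rw [lintegral_add_left (by fun_prop), lintegral_const_mul _ hp, lintegral_const_mul _ hq, hp1,
    hq1, lintegral_add_left (by fun_prop), lintegral_add_left (by fun_prop),
    lintegral_const_mul _ (by fun_prop), lintegral_const_mul _ hp, hp1,
    lintegral_add_left (by fun_prop)] at h1
  set A := (∫⁻ x, φ x * p x ∂m) + (∫⁻ x, (1 - φ x) * q x ∂m) with hA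
  have h2 := h1.trans (add_le_add_right h _)
  rcases eq_or_ne A ∞ with hAt | hAt
  · simp [hAt]
  clear_value A
  lift A to ℝ≥0 using hAt
  simp only [ENNReal.ofReal] at h2 ⊢
  norm_cast at h2 ⊢
  rw [← NNReal.coe_le_coe] at h2 ⊢
  push_cast at h2 ⊢
  rw [Real.coe_toNNReal _ (by positivity), Real.coe_toNNReal _ (by positivity),
    Real.coe_toNNReal _ (by positivity), Real.coe_toNNReal _ (by positivity),
    Real.coe_toNNReal _ (by positivity)] at h2
  rw [Real.coe_toNNReal _ (by positivity)]
  -- The integrated inequality reads `8e + 2 ≤ 8eA + 8e² + 2`.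
  have : 0 ≤ e * ((A : ℝ) + e - 1) := by nlinarith
  nlinarith [nonneg_of_mul_nonneg_right this he]

end General

theorem lambertW0_spec {z : ℝ} (hz : 0 < z) :
    0 < lambertW0 z ∧ lambertW0 z * Real.exp (lambertW0 z) = z := by
  have hex : ∃ w ∈ Set.Ici (-1 : ℝ), w * Real.exp w = z := by
    have hc : ContinuousOn (fun w : ℝ => w * Real.exp w) (Set.Icc 0 z) := by fun_prop
    obtain ⟨w, hw, h⟩ := intermediate_value_Icc hz.le hc
      (show z ∈ _ from ⟨by simpa using hz.le, le_mul_of_one_le_right hz.le (Real.one_le_exp hz.le)⟩)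
    exact ⟨w, le_trans (by norm_num) hw.1, h⟩
  have h := Function.invFunOn_eq hex
  refine ⟨?_, h⟩
  by_contra hneg
  rw [not_lt] at hneg
  have := mul_nonpos_of_nonpos_of_nonneg hneg (Real.exp_pos (lambertW0 z)).le
  exact absurd (h ▸ this : z ≤ 0) (not_le.2 hz)

theorem xi_pos (e : ℝ) : 0 < xi e := Real.exp_pos _

/-- With `W = W₀(4e²)`, `ξ² = e^(-W)` and `W e^W = 4e²` make the exponent equal to `W`; then `1 - W
≤ e^(-W)` gives `e^W ≤ 1 + W e^W`. -/
theorem exp_four_mul_xi_sq_le {e : ℝ} (he : 0 < e) :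
    Real.exp (4 * xi e ^ 2 * e ^ 2) ≤ 1 + 4 * e ^ 2 := by
  obtain ⟨hpos, h⟩ := lambertW0_spec (z := 4 * e ^ 2) (by positivity)
  set W := lambertW0 (4 * e ^ 2) with hW
  have hx : 4 * xi e ^ 2 * e ^ 2 = W := by
    have : xi e ^ 2 = Real.exp (-W) := by
      rw [xi, ← hW, ← Real.exp_nat_mul]; congr 1; push_cast; ring
    rw [this, mul_right_comm, ← h, mul_assoc, ← Real.exp_add]; simp
  rw [hx]
  have h1 := Real.add_one_le_exp (-W)
  have h2 : Real.exp W * Real.exp (-W) = 1 := by rw [← Real.exp_add]; simp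
  nlinarith [Real.exp_pos W]

/-! ### Detection under the sparse law -/

section Channel

variable {𝒳 𝒴 : Type*} [MeasurableSpace 𝒳] [MeasurableSpace 𝒴] {ν : Measure 𝒴}

theorem isProbabilityMeasure_sparseLaw {τ : ℝ} (h0 : 0 ≤ τ) (h1 : τ ≤ 1) (x₀ : 𝒳) (P : Measure 𝒳)
    [IsProbabilityMeasure P] : IsProbabilityMeasure (sparseLaw τ x₀ P) := by
  refine ⟨?_⟩
  simp only [sparseLaw, Measure.add_apply, Measure.smul_apply, measure_univ, smul_eq_mul, mul_one]
  rw [← ENNReal.ofReal_add (by linarith) h0]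
  simp

theorem lintegral_sparseLaw (τ : ℝ) (x₀ : 𝒳) (P : Measure 𝒳) {f : 𝒳 → ℝ≥0∞} (hf : Measurable f) :
    ∫⁻ x, f x ∂sparseLaw τ x₀ P =
      ENNReal.ofReal (1 - τ) * f x₀ + ENNReal.ofReal τ * ∫⁻ x, f x ∂P := by
  simp [sparseLaw, lintegral_add_measure, lintegral_dirac' _ hf]

namespace DensityChannel

theorem measurable_uncurry (K : DensityChannel 𝒳 ν) :
    Measurable fun z : 𝒳 × 𝒴 => (K.density z.1 z.2 : ℝ≥0∞) :=
  K.measurable_density.coe_nnreal_ennreal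

theorem measurable_density_right (K : DensityChannel 𝒳 ν) (x : 𝒳) :
    Measurable fun y => (K.density x y : ℝ≥0∞) :=
  K.measurable_uncurry.comp measurable_prodMk_left

theorem measurable_density_left (K : DensityChannel 𝒳 ν) (y : 𝒴) :
    Measurable fun x => (K.density x y : ℝ≥0∞) :=
  K.measurable_uncurry.comp measurable_prodMk_right

theorem measurable_outputDensity (K : DensityChannel 𝒳 ν) (P : Measure 𝒳) [SFinite P] :
    Measurable (K.outputDensity P) :=
  K.measurable_uncurry.lintegral_prod_left'

theorem lintegral_outputDensity (K : DensityChannel 𝒳 ν) [SigmaFinite ν] (P : Measure 𝒳)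
    [IsProbabilityMeasure P] : ∫⁻ y, K.outputDensity P y ∂ν = 1 := by
  simp only [outputDensity]
  have h : Measurable (Function.uncurry fun (y : 𝒴) (x : 𝒳) => (K.density x y : ℝ≥0∞)) :=
    K.measurable_uncurry.comp measurable_swap
  rw [lintegral_lintegral_swap h.aemeasurable]
  simp [K.lintegral_density]

theorem measurable_blockDensity (K : DensityChannel 𝒳 ν) (n : ℕ) :
    Measurable fun z : (Fin n → 𝒳) × (Fin n → 𝒴) =>
      ∏ i, (K.density (z.1 i) (z.2 i) : ℝ≥0∞) :=
  Finset.measurable_fun_prod _ fun i _ => by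
    have h : Measurable fun z : (Fin n → 𝒳) × (Fin n → 𝒴) => (z.1 i, z.2 i) := by fun_prop
    exact K.measurable_uncurry.comp h

theorem lintegral_blockLaw (K : DensityChannel 𝒳 ν) {n : ℕ} (x : Fin n → 𝒳)
    {f : (Fin n → 𝒴) → ℝ≥0∞} (hf : Measurable f) :
    ∫⁻ y, f y ∂K.blockLaw x =
      ∫⁻ y, (∏ i, (K.density (x i) (y i) : ℝ≥0∞)) * f y ∂(Measure.pi fun _ => ν) :=
  lintegral_withDensity_eq_lintegral_mul _
    ((K.measurable_blockDensity n).comp measurable_prodMk_left) hf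

/-- Second moment of the likelihood ratio between the output of the sparse law and of the innocent
symbol. -/
theorem lintegral_sq_outputDensity_sparseLaw_div_le (D : DensityChannel 𝒳 ν) [SigmaFinite ν]
    (x₀ : 𝒳) (P : Measure 𝒳) [IsProbabilityMeasure P] {τ : ℝ} (h0 : 0 ≤ τ) (h1 : τ ≤ 1) :
    ∫⁻ w, D.outputDensity (sparseLaw τ x₀ P) w ^ 2 / D.density x₀ w ∂ν ≤
      1 + ENNReal.ofReal (τ ^ 2) * D.kernelChiSq x₀ P := by
  have hfin : ∀ᵐ w ∂ν, D.outputDensity P w < ∞ :=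
    ae_lt_top (D.measurable_outputDensity P) (by rw [D.lintegral_outputDensity]; simp)
  have hm := D.measurable_outputDensity P
  have hm0 := D.measurable_density_right x₀
  have hq : ∀ w, D.outputDensity (sparseLaw τ x₀ P) w =
      ENNReal.ofReal (1 - τ) * D.density x₀ w + ENNReal.ofReal τ * D.outputDensity P w :=
    fun w => lintegral_sparseLaw τ x₀ P (D.measurable_density_left w)
  -- With `a` the kernel output density and `p` the innocent one, `(p + τ(a-p))²/p = p + 2τ(a-p) +
  -- τ²(a-p)²/p`; the negative term is moved to the left. The linear terms cancel after integration.
  have hae : ∀ᵐ w ∂ν, D.outputDensity (sparseLaw τ x₀ P) w ^ 2 / D.density x₀ w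
      + ENNReal.ofReal (2 * τ) * D.density x₀ w ≤
      D.density x₀ w + ENNReal.ofReal (2 * τ) * D.outputDensity P w + ENNReal.ofReal (τ ^ 2) *
        (ENNReal.ofReal (((D.outputDensity P w).toReal - (D.density x₀ w : ℝ≥0∞).toReal) ^ 2)
          / D.density x₀ w) := by
    filter_upwards [hfin] with w hw
    rw [hq]
    generalize D.outputDensity P w = a at hw ⊢
    generalize D.density x₀ w = p
    lift a to ℝ≥0 using hw.ne
    rcases eq_or_ne p 0 with rfl | hp
    · rcases eq_or_ne τ 0 with rfl | hτ
      · simp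
      rcases eq_or_ne a 0 with rfl | ha
      · simp
      · have hτ' : 0 < τ := lt_of_le_of_ne h0 hτ.symm
        have ha' : (0 : ℝ) < a := by positivity
        have : ENNReal.ofReal (((a : ℝ≥0∞).toReal - ((0 : ℝ≥0) : ℝ≥0∞).toReal) ^ 2)
          / ((0 : ℝ≥0) : ℝ≥0∞) = ∞ := by
          rw [ENNReal.coe_zero, ENNReal.div_zero]
          simp [ha]
        rw [this, ENNReal.mul_top (by simp only [ne_eq, ENNReal.ofReal_eq_zero, not_le]; positivity)]
        simp
    · have hpp : (0 : ℝ) < p := by positivity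
      simp only [ENNReal.coe_toReal, ENNReal.ofReal]
      rw [← ENNReal.coe_div hp]
      norm_cast
      rw [← NNReal.coe_le_coe]
      push_cast
      rw [Real.coe_toNNReal _ (by linarith), Real.coe_toNNReal _ h0,
        Real.coe_toNNReal _ (by linarith), Real.coe_toNNReal _ (by positivity),
        Real.coe_toNNReal _ (by positivity)]
      apply le_of_eq
      field_simp
      ring
  have hi := lintegral_mono_ae hae
  rw [lintegral_add_right _ (by fun_prop), lintegral_const_mul _ hm0, D.lintegral_density,
    lintegral_add_left (by fun_prop), lintegral_add_left hm0, lintegral_const_mul _ hm,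
    D.lintegral_outputDensity, D.lintegral_density, lintegral_const_mul _ (by fun_prop),
    mul_one, add_right_comm] at hi
  exact ENNReal.le_of_add_le_add_right ENNReal.ofReal_ne_top hi

theorem falseDetection_eq (D : DensityChannel 𝒳 ν) (x₀ : 𝒳) {n : ℕ}
    {φ : (Fin n → 𝒴) → ℝ≥0∞} (hφ : Measurable φ) :
    D.falseDetection x₀ φ =
      ∫⁻ w, φ w * ∏ i, (D.density x₀ (w i) : ℝ≥0∞) ∂(Measure.pi fun _ => ν) := by
  rw [falseDetection, lintegral_blockLaw _ _ hφ]
  simp only [mul_comm]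

/-- Each codeword has the same i.i.d. marginal, so the average over codebooks and messages no longer
depends on `M`: detection puts no limit on the rate. -/
theorem missDetection_eq (D : DensityChannel 𝒳 ν) [SigmaFinite ν] (P : Measure 𝒳)
    [IsProbabilityMeasure P] {M : ℕ} (hM : 0 < M) {n : ℕ}
    {φ : (Fin n → 𝒴) → ℝ≥0∞} (hφ : Measurable φ) :
    D.missDetection P M φ =
      ∫⁻ w, (1 - φ w) * ∏ i, D.outputDensity P (w i) ∂(Measure.pi fun _ => ν) := by
  have hφ' : Measurable fun w => 1 - φ w := by fun_prop
  have hj : Measurable fun z : (Fin n → 𝒳) × (Fin n → 𝒴) =>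
      (∏ i, (D.density (z.1 i) (z.2 i) : ℝ≥0∞)) * (1 - φ z.2) :=
    (D.measurable_blockDensity n).mul (hφ'.comp measurable_snd)
  have hF : Measurable fun c : Fin n → 𝒳 => ∫⁻ w, (1 - φ w) ∂D.blockLaw c := by
    simp_rw [lintegral_blockLaw _ _ hφ']
    exact hj.lintegral_prod_right'
  have hFm : ∀ m : Fin M, Measurable fun c : Fin M → Fin n → 𝒳 =>
      ∫⁻ w, (1 - φ w) ∂D.blockLaw (c m) := fun m => hF.comp (measurable_pi_apply m)
  rw [missDetection, codebookLaw, lintegral_const_mul _ (Finset.measurable_fun_sum _ fun m _ => hFm m),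
    lintegral_finsetSum _ fun m _ => hFm m]
  have he : ∀ m : Fin M, ∫⁻ c : Fin M → Fin n → 𝒳, ∫⁻ w, (1 - φ w) ∂D.blockLaw (c m)
      ∂(Measure.pi fun _ => Measure.pi fun _ => P) =
      ∫⁻ w, (1 - φ w) * ∏ i, D.outputDensity P (w i) ∂(Measure.pi fun _ => ν) := by
    intro m
    rw [(measurePreserving_eval (fun _ : Fin M => Measure.pi fun _ : Fin n => P) m).lintegral_comp
      hF]
    simp_rw [lintegral_blockLaw _ _ hφ']
    rw [lintegral_lintegral_swap hj.aemeasurable]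
    refine lintegral_congr fun w => ?_
    have hb : Measurable fun x : Fin n → 𝒳 => ∏ i, (D.density (x i) (w i) : ℝ≥0∞) :=
      (D.measurable_blockDensity n).comp measurable_prodMk_right
    rw [lintegral_mul_const _ hb,
      lintegral_pi_prod P (fun i x => (D.density x (w i) : ℝ≥0∞))
        fun i => D.measurable_density_left _, mul_comm]
    rfl
  simp only [he, Finset.sum_const, Finset.card_univ, Fintype.card_fin, nsmul_eq_mul]
  rw [← mul_assoc, ENNReal.inv_mul_cancel (by simpa using hM.ne') (by simp), one_mul]

theorem detectionProb_sparseLaw_le (D : DensityChannel 𝒳 ν) [SigmaFinite ν] (x₀ : 𝒳)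
    (P : Measure 𝒳) [IsProbabilityMeasure P] {M n : ℕ} (hM : 0 < M) {τ e : ℝ} (h0 : 0 ≤ τ)
    (h1 : τ ≤ 1) (he : 0 < e) (hχ : D.kernelChiSq x₀ P ≠ ∞)
    (h : Real.exp (n * (τ ^ 2 * (D.kernelChiSq x₀ P).toReal)) ≤ 1 + 4 * e ^ 2) :
    D.detectionProb x₀ (sparseLaw τ x₀ P) M n ≤ ENNReal.ofReal e := by
  have := isProbabilityMeasure_sparseLaw h0 h1 x₀ P
  have hm := D.measurable_outputDensity (sparseLaw τ x₀ P)
  have hm0 := D.measurable_density_right x₀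
  rw [detectionProb, tsub_le_iff_right, add_comm, ← tsub_le_iff_right]
  refine le_iInf fun φ => le_iInf fun hφm => le_iInf fun hφ => ?_
  rw [tsub_le_iff_right, D.falseDetection_eq x₀ hφm, D.missDetection_eq _ hM hφm]
  refine one_le_test_errors_add _ he
    (Finset.measurable_fun_prod _ fun i _ => hm0.comp (measurable_pi_apply i)) (by fun_prop)
    hφm hφ ?_ ?_ ?_
  · rw [lintegral_pi_prod ν (fun _ w => (D.density x₀ w : ℝ≥0∞)) fun _ => hm0]
    simp [D.lintegral_density]
  · rw [lintegral_pi_prod ν (fun _ w => D.outputDensity (sparseLaw τ x₀ P) w) fun _ => hm]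
    simp [D.lintegral_outputDensity]
  · have hp : ∀ w : Fin n → 𝒴, (∏ i, D.outputDensity (sparseLaw τ x₀ P) (w i)) ^ 2 /
        ∏ i, (D.density x₀ (w i) : ℝ≥0∞) =
        ∏ i, D.outputDensity (sparseLaw τ x₀ P) (w i) ^ 2 / (D.density x₀ (w i) : ℝ≥0∞) := by
      intro w
      simp only [div_eq_mul_inv, Finset.prod_mul_distrib, Finset.prod_pow]
      rw [ENNReal.prod_inv_distrib]
      intro i _ j _ _
      simp
    simp_rw [hp]
    rw [lintegral_pi_prod ν
      (fun _ w => D.outputDensity (sparseLaw τ x₀ P) w ^ 2 / (D.density x₀ w : ℝ≥0∞))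
      fun _ => by fun_prop, Finset.prod_const, Finset.card_univ, Fintype.card_fin]
    refine (pow_le_pow_left' (D.lintegral_sq_outputDensity_sparseLaw_div_le x₀ P h0 h1) n).trans ?_
    refine le_trans ?_ (ENNReal.ofReal_le_ofReal h)
    rw [← ENNReal.ofReal_toReal hχ, ← ENNReal.ofReal_mul (by positivity), ← ENNReal.ofReal_one,
      ← ENNReal.ofReal_add (by positivity) (by positivity), ← ENNReal.ofReal_pow (by positivity),
      Real.exp_nat_mul, ENNReal.toReal_ofReal (by positivity)]
    refine ENNReal.ofReal_le_ofReal (pow_le_pow_left₀ (by positivity) ?_ n)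
    rw [add_comm]
    exact Real.add_one_le_exp _

end DensityChannel

end Channel

/-! ### Averaging over random codebooks -/

section RandomCoding

variable {A B : Type*} [MeasurableSpace A] [MeasurableSpace B]

/-- The sent word is independent of its competitors, and Jensen moves the expectation inside the
concave power `ρ ≤ 1`. The factor counts the `N` competitors, not the `N + 1` words, which the
minimal choice of `M` relies on. -/
theorem lintegral_codeword_mul_rpow_sum_le (Q : Measure A) [IsProbabilityMeasure Q] {ρ : ℝ}
    (h0 : 0 < ρ) (h1 : ρ ≤ 1) {N : ℕ} (m : Fin (N + 1)) {f : A → ℝ≥0∞} (hf : Measurable f) :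
    ∫⁻ c : Fin (N + 1) → A, f (c m) * (∑ j : Fin N, f (c (m.succAbove j))) ^ ρ
      ∂(Measure.pi fun _ => Q) ≤ (N : ℝ≥0∞) ^ ρ * (∫⁻ x, f x ∂Q) ^ (1 + ρ) := by
  have hs : Measurable fun c : Fin N → A => ∑ j, f (c j) := by fun_prop
  have hg : Measurable fun z : A × (Fin N → A) => f z.1 * (∑ j, f (z.2 j)) ^ ρ := by fun_prop
  have h2 := (measurePreserving_piFinSuccAbove (fun _ : Fin (N + 1) => Q) m).lintegral_comp hg
  have h3 : ∫⁻ c : Fin (N + 1) → A, f (c m) * (∑ j : Fin N, f (c (m.succAbove j))) ^ ρ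
      ∂(Measure.pi fun _ => Q) = _ := h2
  rw [h3, lintegral_prod_mul hf.aemeasurable (hs.pow_const ρ).aemeasurable]
  calc (∫⁻ x, f x ∂Q) * ∫⁻ c : Fin N → A, (∑ j, f (c j)) ^ ρ ∂(Measure.pi fun _ => Q)
      ≤ (∫⁻ x, f x ∂Q) * (∫⁻ c : Fin N → A, ∑ j, f (c j) ∂(Measure.pi fun _ => Q)) ^ ρ := by
        gcongr
        exact lintegral_rpow_le_rpow_lintegral _ h0 h1 hs
    _ = (∫⁻ x, f x ∂Q) * (N * ∫⁻ x, f x ∂Q) ^ ρ := by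
        have hfj : ∀ j : Fin N, Measurable fun c : Fin N → A => f (c j) := fun j =>
          hf.comp (measurable_pi_apply j)
        rw [lintegral_finsetSum _ fun j _ => hfj j]
        have he : ∀ j : Fin N, ∫⁻ c : Fin N → A, f (c j) ∂(Measure.pi fun _ => Q) = ∫⁻ x, f x ∂Q :=
          fun j => (measurePreserving_eval (fun _ : Fin N => Q) j).lintegral_comp hf
        simp [he]
    _ = _ := by
        rw [ENNReal.mul_rpow_of_nonneg _ _ h0.le, ENNReal.rpow_add_of_nonneg _ _ zero_le_one h0.le,
          ENNReal.rpow_one]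
        ring

theorem lintegral_gallagerBound_le (Q : Measure A) [IsProbabilityMeasure Q] (lam : Measure B)
    [SigmaFinite lam] {ρ : ℝ} (h0 : 0 < ρ) (h1 : ρ ≤ 1) (N : ℕ) {F : A → B → ℝ≥0∞}
    (hF : Measurable (Function.uncurry F)) :
    ∫⁻ c : Fin (N + 1) → A, ((N + 1 : ℕ) : ℝ≥0∞)⁻¹ *
      ∑ m, ∫⁻ y, F (c m) y * (∑ j : Fin N, F (c (m.succAbove j)) y) ^ ρ ∂lam
      ∂(Measure.pi fun _ => Q) ≤
      (N : ℝ≥0∞) ^ ρ * ∫⁻ y, (∫⁻ x, F x y ∂Q) ^ (1 + ρ) ∂lam := by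
  have hFc : ∀ i : Fin (N + 1), Measurable fun z : (Fin (N + 1) → A) × B => F (z.1 i) z.2 :=
    fun i => hF.comp (by fun_prop : Measurable fun z : (Fin (N + 1) → A) × B => (z.1 i, z.2))
  have hj : ∀ m : Fin (N + 1), Measurable (Function.uncurry fun (c : Fin (N + 1) → A) (y : B) =>
      F (c m) y * (∑ j : Fin N, F (c (m.succAbove j)) y) ^ ρ) := fun m =>
    (hFc m).mul ((Finset.measurable_fun_sum _ fun j _ => hFc (m.succAbove j)).pow_const ρ)
  have hm : ∀ m : Fin (N + 1), Measurable fun c : Fin (N + 1) → A =>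
      ∫⁻ y, F (c m) y * (∑ j : Fin N, F (c (m.succAbove j)) y) ^ ρ ∂lam := fun m =>
    (hj m).lintegral_prod_right'
  rw [lintegral_const_mul _ (Finset.measurable_fun_sum _ fun m _ => hm m),
    lintegral_finsetSum _ fun m _ => hm m]
  have hA : Measurable fun y => (∫⁻ x, F x y ∂Q) ^ (1 + ρ) :=
    hF.lintegral_prod_left'.pow_const _
  have he : ∀ m : Fin (N + 1), ∫⁻ c : Fin (N + 1) → A,
      ∫⁻ y, F (c m) y * (∑ j : Fin N, F (c (m.succAbove j)) y) ^ ρ ∂lam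
      ∂(Measure.pi fun _ => Q) ≤ (N : ℝ≥0∞) ^ ρ * ∫⁻ y, (∫⁻ x, F x y ∂Q) ^ (1 + ρ) ∂lam := by
    intro m
    rw [lintegral_lintegral_swap (hj m).aemeasurable, ← lintegral_const_mul _ hA]
    exact lintegral_mono fun y => lintegral_codeword_mul_rpow_sum_le Q h0 h1 m
      (hF.comp measurable_prodMk_right)
  calc _ ≤ ((N + 1 : ℕ) : ℝ≥0∞)⁻¹ * ∑ _m : Fin (N + 1),
        (N : ℝ≥0∞) ^ ρ * ∫⁻ y, (∫⁻ x, F x y ∂Q) ^ (1 + ρ) ∂lam := by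
        gcongr with m
        exact he m
    _ = _ := by
        rw [Finset.sum_const, Finset.card_univ, Fintype.card_fin, nsmul_eq_mul, ← mul_assoc,
          ENNReal.inv_mul_cancel (by simp) (by simp), one_mul]

end RandomCoding

/-! ### Gallager's bound and its exponent for the sparse law -/

section Channel

variable {𝒳 𝒴 : Type*} [MeasurableSpace 𝒳] [MeasurableSpace 𝒴] {ν : Measure 𝒴}

namespace DensityChannel

/-- The integral whose negative logarithm is Gallager's function. -/
noncomputable def gallagerIntegral (K : DensityChannel 𝒳 ν) (ρ : ℝ) (P : Measure 𝒳) : ℝ≥0∞ :=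
  ∫⁻ y, (∫⁻ x, (K.density x y : ℝ≥0∞) ^ (1 / (1 + ρ)) ∂P) ^ (1 + ρ) ∂ν

/-- A maximum likelihood decoder has error probability at most Gallager's bound. -/
theorem exists_avgDecodingError_le (K : DensityChannel 𝒳 ν) {N n : ℕ}
    (c : Fin (N + 1) → Fin n → 𝒳) {ρ : ℝ} (h0 : 0 < ρ) :
    ∃ dec : (Fin n → 𝒴) → Fin (N + 1), Measurable dec ∧
      K.avgDecodingError c dec ≤ ((N + 1 : ℕ) : ℝ≥0∞)⁻¹ *
        ∑ m, ∫⁻ y, (∏ i, (K.density (c m i) (y i) : ℝ≥0∞) ^ (1 / (1 + ρ))) *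
          (∑ j : Fin N, ∏ i, (K.density (c (m.succAbove j) i) (y i) : ℝ≥0∞) ^ (1 / (1 + ρ))) ^ ρ
          ∂(Measure.pi fun _ => ν) := by
  have hρ : (0 : ℝ) < 1 + ρ := by linarith
  have hs : 0 ≤ 1 / (1 + ρ) := by positivity
  have hm : ∀ m, Measurable fun y : Fin n → 𝒴 => ∏ i, (K.density (c m i) (y i) : ℝ≥0∞) := fun m =>
    (K.measurable_blockDensity n).comp measurable_prodMk_left
  obtain ⟨dec, hdec, hmax⟩ := exists_measurable_argmax
    (fun m (y : Fin n → 𝒴) => ∏ i, (K.density (c m i) (y i) : ℝ≥0∞)) hm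
  refine ⟨dec, hdec, ?_⟩
  rw [avgDecodingError]
  gcongr with m
  have hset : MeasurableSet {y | dec y ≠ m} := (hdec (measurableSet_singleton m)).compl
  rw [blockLaw, withDensity_apply _ hset, ← lintegral_indicator hset]
  refine lintegral_mono fun y => ?_
  refine Set.indicator_apply_le' (fun hy => ?_) fun _ => zero_le
  -- On an error the decoded word is a competitor at least as likely as word `m`, so its term alone
  -- makes the sum large enough.
  obtain ⟨j, hj⟩ := Fin.exists_succAbove_eq (show dec y ≠ m from hy)
  simp_rw [ENNReal.prod_rpow_of_nonneg hs]
  calc ∏ i, (K.density (c m i) (y i) : ℝ≥0∞)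
      = (∏ i, (K.density (c m i) (y i) : ℝ≥0∞)) ^ (1 / (1 + ρ)) *
          ((∏ i, (K.density (c m i) (y i) : ℝ≥0∞)) ^ (1 / (1 + ρ))) ^ ρ := by
        rw [← ENNReal.rpow_mul, ← ENNReal.rpow_add_of_nonneg _ _ hs (by positivity)]
        have : 1 / (1 + ρ) + 1 / (1 + ρ) * ρ = 1 := by field_simp
        rw [this, ENNReal.rpow_one]
    _ ≤ _ := by
        gcongr
        refine le_trans ?_ (Finset.single_le_sum (fun _ _ => zero_le) (Finset.mem_univ j))
        rw [hj]
        exact ENNReal.rpow_le_rpow (hmax y m) hs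

theorem measurable_rpow_density (K : DensityChannel 𝒳 ν) (s : ℝ) :
    Measurable (Function.uncurry fun (x : 𝒳) (y : 𝒴) => (K.density x y : ℝ≥0∞) ^ s) :=
  K.measurable_uncurry.pow_const s

theorem measurable_lintegral_rpow_density (K : DensityChannel 𝒳 ν) (s : ℝ) (P : Measure 𝒳)
    [SFinite P] : Measurable fun y => ∫⁻ x, (K.density x y : ℝ≥0∞) ^ s ∂P :=
  (K.measurable_rpow_density s).lintegral_prod_left'

/-- Gallager's random coding bound. -/
theorem codebookLaw_exists_decoder_pos (K : DensityChannel 𝒳 ν) [SigmaFinite ν] (P : Measure 𝒳)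
    [IsProbabilityMeasure P] (N n : ℕ) {ρ : ℝ} (h0 : 0 < ρ) (h1 : ρ ≤ 1) :
    0 < codebookLaw P (N + 1) n {c | ∃ dec : (Fin n → 𝒴) → Fin (N + 1), Measurable dec ∧
      K.avgDecodingError c dec ≤ (N : ℝ≥0∞) ^ ρ * K.gallagerIntegral ρ P ^ n} := by
  have hρ : (0 : ℝ) ≤ 1 + ρ := by linarith
  set F : (Fin n → 𝒳) → (Fin n → 𝒴) → ℝ≥0∞ := fun x y =>
    ∏ i, (K.density (x i) (y i) : ℝ≥0∞) ^ (1 / (1 + ρ)) with hFdef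
  have hF : Measurable (Function.uncurry F) :=
    Finset.measurable_fun_prod _ fun i _ => by
      have h : Measurable fun z : (Fin n → 𝒳) × (Fin n → 𝒴) => (z.1 i, z.2 i) := by fun_prop
      exact (K.measurable_uncurry.comp h).pow_const _
  have hI : ∫⁻ y, (∫⁻ x, F x y ∂(Measure.pi fun _ => P)) ^ (1 + ρ) ∂(Measure.pi fun _ => ν) =
      K.gallagerIntegral ρ P ^ n := by
    have h : ∀ y : Fin n → 𝒴, (∫⁻ x, F x y ∂(Measure.pi fun _ => P)) ^ (1 + ρ) =
        ∏ i, (∫⁻ x, (K.density x (y i) : ℝ≥0∞) ^ (1 / (1 + ρ)) ∂P) ^ (1 + ρ) := by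
      intro y
      rw [lintegral_pi_prod P (fun i x => (K.density x (y i) : ℝ≥0∞) ^ (1 / (1 + ρ)))
        fun i => (K.measurable_density_left _).pow_const _, ENNReal.prod_rpow_of_nonneg hρ]
    simp_rw [h]
    rw [lintegral_pi_prod ν
      (fun _ y => (∫⁻ x, (K.density x y : ℝ≥0∞) ^ (1 / (1 + ρ)) ∂P) ^ (1 + ρ))
      fun _ => (K.measurable_lintegral_rpow_density _ P).pow_const _]
    simp [gallagerIntegral]
  have hb := lintegral_gallagerBound_le (Measure.pi fun _ : Fin n => P)
    (Measure.pi fun _ : Fin n => ν) h0 h1 N hF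
  rw [hI] at hb
  have hFc : ∀ i : Fin (N + 1), Measurable fun z : (Fin (N + 1) → Fin n → 𝒳) × (Fin n → 𝒴) =>
      F (z.1 i) z.2 := fun i => hF.comp
    (by fun_prop : Measurable fun z : (Fin (N + 1) → Fin n → 𝒳) × (Fin n → 𝒴) => (z.1 i, z.2))
  have hmeas : Measurable fun c : Fin (N + 1) → Fin n → 𝒳 => ((N + 1 : ℕ) : ℝ≥0∞)⁻¹ *
      ∑ m, ∫⁻ y, F (c m) y * (∑ j : Fin N, F (c (m.succAbove j)) y) ^ ρ
        ∂(Measure.pi fun _ => ν) := by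
    refine Measurable.const_mul (Finset.measurable_fun_sum _ fun m _ => ?_) _
    exact Measurable.lintegral_prod_right' (f := fun z : (Fin (N + 1) → Fin n → 𝒳) ×
      (Fin n → 𝒴) => F (z.1 m) z.2 * (∑ j : Fin N, F (z.1 (m.succAbove j)) z.2) ^ ρ)
      ((hFc m).mul ((Finset.measurable_fun_sum _ fun j _ => hFc (m.succAbove j)).pow_const ρ))
  -- A function is at most its mean with positive probability; only this function, not the set of
  -- good codebooks, has to be measurable.
  refine (measure_le_lintegral_pos (μ := Measure.pi fun _ : Fin (N + 1) =>
    Measure.pi fun _ : Fin n => P) hmeas.aemeasurable).trans_le (measure_mono fun c hc => ?_)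
  obtain ⟨dec, hdec, h⟩ := K.exists_avgDecodingError_le c h0
  exact ⟨dec, hdec, h.trans (le_trans hc hb)⟩

theorem gallagerIntegral_le_one (K : DensityChannel 𝒳 ν) [SigmaFinite ν] (P : Measure 𝒳)
    [IsProbabilityMeasure P] {ρ : ℝ} (h0 : 0 < ρ) : K.gallagerIntegral ρ P ≤ 1 := by
  have hρ : (0 : ℝ) < 1 + ρ := by linarith
  rw [← K.lintegral_outputDensity P]
  refine lintegral_mono fun y => ?_
  have h := lintegral_rpow_le_rpow_lintegral P (ρ := 1 / (1 + ρ)) (by positivity)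
    (by rw [div_le_one hρ]; linarith) (K.measurable_density_left y)
  have h2 := ENNReal.rpow_le_rpow h hρ.le
  rwa [← ENNReal.rpow_mul _ (1 / (1 + ρ)), one_div_mul_cancel hρ.ne', ENNReal.rpow_one] at h2

/-- Minkowski's inequality in `L^(1+ρ)`, applied to the inner integral, which is linear in the input
law; the part from `x₀` has norm one. -/
theorem gallagerIntegral_sparseLaw_le (K : DensityChannel 𝒳 ν) (x₀ : 𝒳) (P : Measure 𝒳)
    [IsProbabilityMeasure P] {ρ : ℝ} (h0 : 0 < ρ) (τ : ℝ) :
    K.gallagerIntegral ρ (sparseLaw τ x₀ P) ≤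
      (ENNReal.ofReal (1 - τ) + ENNReal.ofReal τ * K.gallagerIntegral ρ P ^ (1 / (1 + ρ)))
        ^ (1 + ρ) := by
  have hρ : (0 : ℝ) < 1 + ρ := by linarith
  have hm0 := (K.measurable_density_right x₀).pow_const (1 / (1 + ρ))
  have hm := K.measurable_lintegral_rpow_density (1 / (1 + ρ)) P
  have hc : ∀ (a : ℝ≥0∞) (f : 𝒴 → ℝ≥0∞), Measurable f →
      (∫⁻ y, (a * f y) ^ (1 + ρ) ∂ν) ^ (1 / (1 + ρ)) =
        a * (∫⁻ y, f y ^ (1 + ρ) ∂ν) ^ (1 / (1 + ρ)) := by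
    intro a f hf
    simp_rw [ENNReal.mul_rpow_of_nonneg _ _ hρ.le]
    rw [lintegral_const_mul _ (hf.pow_const _), ENNReal.mul_rpow_of_nonneg _ _ (by positivity),
      ← ENNReal.rpow_mul, mul_one_div_cancel hρ.ne', ENNReal.rpow_one]
  have hmink := ENNReal.lintegral_Lp_add_le (μ := ν) (p := 1 + ρ)
    (hm0.const_mul (ENNReal.ofReal (1 - τ))).aemeasurable
    (hm.const_mul (ENNReal.ofReal τ)).aemeasurable (by linarith)
  simp only [Pi.add_apply] at hmink
  rw [hc _ _ hm0, hc _ _ hm] at hmink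
  have hone : ∫⁻ y, ((K.density x₀ y : ℝ≥0∞) ^ (1 / (1 + ρ))) ^ (1 + ρ) ∂ν = 1 := by
    simp_rw [← ENNReal.rpow_mul, one_div_mul_cancel hρ.ne', ENNReal.rpow_one]
    exact K.lintegral_density x₀
  rw [hone, ENNReal.one_rpow, mul_one] at hmink
  have h2 := ENNReal.rpow_le_rpow hmink hρ.le
  rw [← ENNReal.rpow_mul, one_div_mul_cancel hρ.ne', ENNReal.rpow_one] at h2
  refine le_trans (le_of_eq ?_) h2
  refine lintegral_congr fun y => ?_
  rw [lintegral_sparseLaw τ x₀ P ((K.measurable_density_left y).pow_const _)]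

/-- Equality for a positive integral. At zero, `Real.log 0 = 0` makes the right side `1`, so the
inequality avoids proving positivity. -/
theorem exp_neg_gallagerE0_ge (K : DensityChannel 𝒳 ν) (P : Measure 𝒳) (ρ s : ℝ) (hs : 0 < s) :
    (K.gallagerIntegral ρ P).toReal ^ s ≤ Real.exp (-s * K.gallagerE0 ρ P) := by
  have he : K.gallagerE0 ρ P = -Real.log (K.gallagerIntegral ρ P).toReal := rfl
  rcases (ENNReal.toReal_nonneg (a := K.gallagerIntegral ρ P)).eq_or_lt with h | h
  · rw [← h, Real.zero_rpow hs.ne']; positivity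
  · rw [Real.rpow_def_of_pos h, he]
    apply le_of_eq
    congr 1
    ring

theorem gallagerIntegral_sparseLaw_le_exp (K : DensityChannel 𝒳 ν) [SigmaFinite ν] (x₀ : 𝒳)
    (P : Measure 𝒳) [IsProbabilityMeasure P] {ρ τ : ℝ} (h0 : 0 < ρ) (hτ0 : 0 ≤ τ) (hτ1 : τ ≤ 1) :
    K.gallagerIntegral ρ (sparseLaw τ x₀ P) ≤ ENNReal.ofReal (Real.exp
      (-(τ * (1 + ρ) * (1 - Real.exp (-(1 / (1 + ρ)) * K.gallagerE0 ρ P))))) := by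
  have hρ : (0 : ℝ) < 1 + ρ := by linarith
  have hfin : K.gallagerIntegral ρ P ≠ ∞ :=
    ne_top_of_le_ne_top ENNReal.one_ne_top (K.gallagerIntegral_le_one P h0)
  have h := K.exp_neg_gallagerE0_ge P ρ (1 / (1 + ρ)) (by positivity)
  set t := Real.exp (-(1 / (1 + ρ)) * K.gallagerE0 ρ P)
  have ht : 0 ≤ t := (Real.exp_pos _).le
  refine (K.gallagerIntegral_sparseLaw_le x₀ P h0 τ).trans ?_
  have hle : ENNReal.ofReal (1 - τ) +
      ENNReal.ofReal τ * K.gallagerIntegral ρ P ^ (1 / (1 + ρ)) ≤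
      ENNReal.ofReal (Real.exp (-(τ * (1 - t)))) := by
    rw [← ENNReal.ofReal_toReal hfin, ENNReal.ofReal_rpow_of_nonneg ENNReal.toReal_nonneg
      (by positivity), ← ENNReal.ofReal_mul hτ0, ← ENNReal.ofReal_add (by linarith) (by positivity)]
    refine ENNReal.ofReal_le_ofReal ?_
    have h1 := Real.add_one_le_exp (-(τ * (1 - t)))
    nlinarith [mul_le_mul_of_nonneg_left h hτ0]
  refine (ENNReal.rpow_le_rpow hle hρ.le).trans (le_of_eq ?_)
  rw [ENNReal.ofReal_rpow_of_pos (Real.exp_pos _), ← Real.exp_mul]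
  congr 2
  ring

/-- Fatou's lemma twice, over inputs and over outputs, so no moment condition on the densities is
needed. This is what forces `E₀(ρ)` towards `0`. -/
theorem one_le_liminf_gallagerIntegral (K : DensityChannel 𝒳 ν) [SigmaFinite ν] (P : Measure 𝒳)
    [IsProbabilityMeasure P] :
    1 ≤ Filter.liminf (fun ρ : ℝ => K.gallagerIntegral ρ P) (nhdsWithin 0 (Set.Ioi 0)) := by
  have hin : ∀ y, K.outputDensity P y ≤ Filter.liminf
      (fun ρ : ℝ => ∫⁻ x, (K.density x y : ℝ≥0∞) ^ (1 / (1 + ρ)) ∂P)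
      (nhdsWithin 0 (Set.Ioi 0)) := by
    intro y
    refine le_trans (le_of_eq ?_) (lintegral_liminf_le
      fun ρ : ℝ => (K.measurable_density_left y).pow_const (1 / (1 + ρ)))
    refine lintegral_congr fun x => ?_
    refine (Filter.Tendsto.liminf_eq ?_).symm
    have hc : Filter.Tendsto (fun ρ : ℝ => 1 / (1 + ρ)) (nhdsWithin 0 (Set.Ioi 0)) (nhds 1) := by
      have : ContinuousAt (fun ρ : ℝ => 1 / (1 + ρ)) 0 := by
        refine ContinuousAt.div continuousAt_const (by fun_prop) (by norm_num)
      simpa using this.tendsto.mono_left nhdsWithin_le_nhds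
    rcases eq_or_ne (K.density x y) 0 with h | h
    · rw [h]
      refine tendsto_const_nhds.congr' ?_
      filter_upwards [self_mem_nhdsWithin] with ρ hρ
      have : (0 : ℝ) < ρ := hρ
      rw [ENNReal.coe_zero, ENNReal.zero_rpow_of_pos (by positivity)]
    · have h2 : Filter.Tendsto (fun ρ : ℝ => (K.density x y) ^ (1 / (1 + ρ)))
          (nhdsWithin 0 (Set.Ioi 0)) (nhds (K.density x y)) := by
        simpa using (tendsto_const_nhds (x := K.density x y)).nnrpow hc (Or.inl h)
      refine (ENNReal.tendsto_coe.2 h2).congr fun ρ => ?_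
      rw [ENNReal.coe_rpow_of_ne_zero h]
  rw [← K.lintegral_outputDensity P]
  refine le_trans (lintegral_mono fun y => ?_) (lintegral_liminf_le
    fun ρ : ℝ => (K.measurable_lintegral_rpow_density (1 / (1 + ρ)) P).pow_const (1 + ρ))
  -- The base and the exponent `1 + ρ` vary together; a constant `c` below the limiting base
  -- separates them, since `c^(1+ρ) → c`.
  refine le_of_forall_lt fun b hb => ?_
  obtain ⟨c, hbc, hc⟩ := exists_between hb
  refine lt_of_lt_of_le hbc ?_
  have hev := Filter.eventually_lt_of_lt_liminf (hc.trans_le (hin y))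
  lift c to ℝ≥0 using hc.ne_top
  have hc0 : c ≠ 0 := by rintro rfl; simp at hbc
  have h1 : Filter.Tendsto (fun ρ : ℝ => (c : ℝ≥0∞) ^ (1 + ρ))
      (nhdsWithin 0 (Set.Ioi 0)) (nhds c) := by
    have hc : Filter.Tendsto (fun ρ : ℝ => 1 + ρ) (nhdsWithin 0 (Set.Ioi 0)) (nhds 1) := by
      have : ContinuousAt (fun ρ : ℝ => 1 + ρ) 0 := by fun_prop
      simpa using this.tendsto.mono_left nhdsWithin_le_nhds
    have h2 : Filter.Tendsto (fun ρ : ℝ => c ^ (1 + ρ))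
        (nhdsWithin 0 (Set.Ioi 0)) (nhds c) := by
      simpa using (tendsto_const_nhds (x := c)).nnrpow hc (Or.inl hc0)
    refine (ENNReal.tendsto_coe.2 h2).congr fun ρ => ?_
    rw [ENNReal.coe_rpow_of_ne_zero hc0]
  rw [← h1.liminf_eq]
  refine Filter.liminf_le_liminf ?_
  filter_upwards [hev, self_mem_nhdsWithin] with ρ h hρ
  have : (0 : ℝ) < ρ := hρ
  exact ENNReal.rpow_le_rpow h.le (by linarith)

theorem eventually_gallagerE0_lt (K : DensityChannel 𝒳 ν) [SigmaFinite ν] (P : Measure 𝒳)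
    [IsProbabilityMeasure P] {η : ℝ} (hη : 0 < η) :
    ∀ᶠ ρ in nhdsWithin (0 : ℝ) (Set.Ioi 0), K.gallagerE0 ρ P < η := by
  have h : ENNReal.ofReal (Real.exp (-η)) < Filter.liminf
      (fun ρ : ℝ => K.gallagerIntegral ρ P) (nhdsWithin 0 (Set.Ioi 0)) := by
    refine lt_of_lt_of_le ?_ (K.one_le_liminf_gallagerIntegral P)
    rw [ENNReal.ofReal_lt_one]
    simpa using hη
  filter_upwards [Filter.eventually_lt_of_lt_liminf h, self_mem_nhdsWithin] with ρ h hρ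
  have hfin : K.gallagerIntegral ρ P ≠ ∞ :=
    ne_top_of_le_ne_top ENNReal.one_ne_top (K.gallagerIntegral_le_one P hρ)
  have h2 : Real.exp (-η) < (K.gallagerIntegral ρ P).toReal :=
    (ENNReal.ofReal_lt_iff_lt_toReal (Real.exp_pos _).le hfin).1 h
  have he : K.gallagerE0 ρ P = -Real.log (K.gallagerIntegral ρ P).toReal := rfl
  rw [he]
  have := (Real.lt_log_iff_exp_lt ((Real.exp_pos _).trans h2)).2 h2
  linarith

end DensityChannel

end Channel

/-! ### Existence of a finite number of messages valid for all `ρ` -/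

/-- The rate exponents `(T (1 + ρ) (1 - e ^ (-E₀(ρ) / (1 + ρ))) + log ε) / (ρ log 2)` are bounded
over `0 < ρ ≤ 1`. -/
theorem DensityChannel.exists_nat_rpow_le {𝒳 𝒴 : Type*} [MeasurableSpace 𝒳] [MeasurableSpace 𝒴]
    {ν : Measure 𝒴} [SigmaFinite ν] (K : DensityChannel 𝒳 ν) (P : Measure 𝒳)
    [IsProbabilityMeasure P] {T e : ℝ} (hT : 0 < T) (he0 : 0 < e) (he1 : e < 1) :
    ∃ C : ℕ, ∀ ρ : ℝ, 0 < ρ → ρ ≤ 1 → (2 : ℝ) ^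
      ((T * (1 + ρ) * (1 - Real.exp (-(1 / (1 + ρ)) * K.gallagerE0 ρ P)) + Real.log e) /
        (ρ * Real.log 2)) ≤ C := by
  have hl2 : 0 < Real.log 2 := Real.log_pos one_lt_two
  have hle : Real.log e < 0 := Real.log_neg he0 he1
  -- Below this threshold `T * E₀ + log e < 0`, and `(1+ρ)(1 - e^(-E₀/(1+ρ))) ≤ E₀`, so the
  -- numerator is nonpositive for `ρ < δ`. For `ρ ≥ δ` it is at most `2T`, over a denominator at
  -- least `δ log 2`.
  have hev := K.eventually_gallagerE0_lt P (η := -Real.log e / T)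
    (div_pos (by linarith) hT)
  obtain ⟨δ, hδ, hsub⟩ := (mem_nhdsGT_iff_exists_Ioo_subset (a := (0 : ℝ))).1 hev
  have hδ : 0 < δ := hδ
  obtain ⟨C, hC⟩ := exists_nat_ge ((2 : ℝ) ^ (2 * T / (δ * Real.log 2)))
  refine ⟨C, fun ρ h0 h1 => le_trans ?_ hC⟩
  refine Real.rpow_le_rpow_of_exponent_le one_le_two ?_
  have hρ : 0 < 1 + ρ := by linarith
  rcases lt_or_ge ρ δ with h | h
  · have hE : K.gallagerE0 ρ P < -Real.log e / T := hsub ⟨h0, h⟩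
    rw [lt_div_iff₀ hT] at hE
    have hexp := Real.add_one_le_exp (-(1 / (1 + ρ)) * K.gallagerE0 ρ P)
    have h3 : (1 + ρ) * (1 - Real.exp (-(1 / (1 + ρ)) * K.gallagerE0 ρ P)) ≤ K.gallagerE0 ρ P := by
      have h4 : (1 + ρ) * (1 / (1 + ρ) * K.gallagerE0 ρ P) = K.gallagerE0 ρ P := by field_simp
      rw [← h4]
      refine mul_le_mul_of_nonneg_left ?_ hρ.le
      rw [h4]
      linarith
    have h5 : T * (1 + ρ) * (1 - Real.exp (-(1 / (1 + ρ)) * K.gallagerE0 ρ P)) + Real.log e ≤ 0 := by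
      rw [mul_assoc]
      nlinarith [mul_le_mul_of_nonneg_left h3 hT.le]
    exact (div_nonpos_of_nonpos_of_nonneg h5 (by positivity)).trans (by positivity)
  · refine div_le_div₀ (by positivity) ?_ (by positivity) (by gcongr)
    have hexp := Real.exp_pos (-(1 / (1 + ρ)) * K.gallagerE0 ρ P)
    have : T * (1 + ρ) * (1 - Real.exp (-(1 / (1 + ρ)) * K.gallagerE0 ρ P)) ≤ T * 2 * 1 := by
      refine mul_le_mul_of_nonneg (by gcongr; linarith) (by linarith) (by positivity) (by norm_num)
    linarith

end LPD

/-! ### The main theorem -/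

theorem theorem2 {𝒳 𝒴 𝒲 : Type*} [MeasurableSpace 𝒳] [MeasurableSpace 𝒴] [MeasurableSpace 𝒲]
    (ν : Measure 𝒴) [SigmaFinite ν] (μ : Measure 𝒲) [SigmaFinite μ]
    (K : LPD.DensityChannel 𝒳 ν) (D : LPD.DensityChannel 𝒳 μ)
    (x₀ : 𝒳) (P : Measure 𝒳) [IsProbabilityMeasure P]
    (n : ℕ) (hn : 0 < n)
    (εdet εdec : ℝ) (hdet : 0 < εdet) (hdet1 : εdet < 1) (hdec : 0 < εdec) (hdec1 : εdec < 1)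
    (hχ0 : D.kernelChiSq x₀ P ≠ 0) (hχtop : D.kernelChiSq x₀ P ≠ ∞)
    (τ : ℝ) (hτ : τ = 2 * LPD.xi εdet * εdet / √(n * (D.kernelChiSq x₀ P).toReal))
    (hτ1 : τ ≤ 1) :
    ∃ M : ℕ, 0 < M ∧
      0 < LPD.codebookLaw (LPD.sparseLaw τ x₀ P) M n
        {c | ∃ dec : (Fin n → 𝒴) → Fin M, Measurable dec ∧
          K.avgDecodingError c dec ≤ ENNReal.ofReal εdec} ∧
      D.detectionProb x₀ (LPD.sparseLaw τ x₀ P) M n ≤ ENNReal.ofReal εdet ∧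
      ∀ ρ : ℝ, 0 < ρ → ρ ≤ 1 →
        Real.logb 2 M ≥ εdet * √n * LPD.coeffL K D x₀ P εdet ρ + 1 / ρ * Real.logb 2 εdec := by
  have hl2 : 0 < Real.log 2 := Real.log_pos one_lt_two
  have hχ : 0 < (D.kernelChiSq x₀ P).toReal := ENNReal.toReal_pos hχ0 hχtop
  have hn' : (0 : ℝ) < n := by exact_mod_cast hn
  have hξ := LPD.xi_pos εdet
  have hτ0 : 0 < τ := by rw [hτ]; positivity
  have := LPD.isProbabilityMeasure_sparseLaw hτ0.le hτ1 x₀ P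
  have hT : 0 < n * τ := by positivity
  have hTeq : n * τ = 2 * LPD.xi εdet * εdet * √n / √(D.kernelChiSq x₀ P).toReal := by
    rw [hτ, Real.sqrt_mul hn'.le]
    have h := Real.sq_sqrt hn'.le
    field_simp
    rw [h]
  have hR : ∀ ρ : ℝ, 0 < ρ →
      εdet * √n * LPD.coeffL K D x₀ P εdet ρ + 1 / ρ * Real.logb 2 εdec =
      (n * τ * (1 + ρ) * (1 - Real.exp (-(1 / (1 + ρ)) * K.gallagerE0 ρ P)) + Real.log εdec) /
        (ρ * Real.log 2) := by
    intro ρ h0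
    rw [hTeq, LPD.coeffL, Real.logb]
    generalize 1 - Real.exp (-(1 / (1 + ρ)) * K.gallagerE0 ρ P) = t
    field_simp
  classical
  -- `M` is the least such bound: `hspec` is the rate claim for every `ρ`, and `hmin` at `M - 1`
  -- supplies the one `ρ` used for decoding.
  have hex := K.exists_nat_rpow_le P hT hdec hdec1
  have hspec := Nat.find_spec hex
  have hmin := fun m => Nat.find_min hex (m := m)
  generalize Nat.find hex = M at hspec hmin
  have hM : 0 < M := by
    rw [Nat.pos_iff_ne_zero]
    rintro rfl
    have h := hspec 1 one_pos le_rfl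
    rw [Nat.cast_zero] at h
    exact absurd h (not_le.2 (Real.rpow_pos_of_pos two_pos _))
  obtain ⟨N, rfl⟩ : ∃ N, M = N + 1 := ⟨M - 1, by omega⟩
  refine ⟨N + 1, hM, ?_, ?_, fun ρ h0 h1 => ?_⟩
  · have hN := hmin N (Nat.lt_succ_self N)
    push Not at hN
    obtain ⟨ρ, h0, h1, hlt⟩ := hN
    refine (K.codebookLaw_exists_decoder_pos (LPD.sparseLaw τ x₀ P) N n h0 h1).trans_le
      (measure_mono ?_)
    rintro c ⟨dec, hd, h⟩
    refine ⟨dec, hd, h.trans ?_⟩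
    have hG := K.gallagerIntegral_sparseLaw_le_exp x₀ P h0 hτ0.le hτ1
    set t := 1 - Real.exp (-(1 / (1 + ρ)) * K.gallagerE0 ρ P)
    -- The exponent `n τ (1+ρ) t` cancels exactly against the `n`-th power of the bound `hG`,
    -- leaving `εdec`.
    have hNρ : (N : ℝ) ^ ρ ≤ Real.exp (n * τ * (1 + ρ) * t + Real.log εdec) := by
      refine (Real.rpow_le_rpow (Nat.cast_nonneg N) hlt.le h0.le).trans (le_of_eq ?_)
      rw [← Real.rpow_mul two_pos.le, Real.rpow_def_of_pos two_pos]
      congr 1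
      field_simp
    calc (N : ℝ≥0∞) ^ ρ * K.gallagerIntegral ρ (LPD.sparseLaw τ x₀ P) ^ n
        ≤ ENNReal.ofReal (Real.exp (n * τ * (1 + ρ) * t + Real.log εdec)) *
          ENNReal.ofReal (Real.exp (-(τ * (1 + ρ) * t))) ^ n := by
          gcongr
          rw [← ENNReal.ofReal_natCast, ENNReal.ofReal_rpow_of_nonneg (Nat.cast_nonneg N) h0.le]
          exact ENNReal.ofReal_le_ofReal hNρ
      _ = ENNReal.ofReal εdec := by
          rw [← ENNReal.ofReal_pow (Real.exp_pos _).le, ← ENNReal.ofReal_mul (Real.exp_pos _).le,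
            ← Real.exp_nat_mul, ← Real.exp_add]
          congr 1
          nth_rewrite 2 [← Real.exp_log hdec]
          congr 1
          ring
  · refine D.detectionProb_sparseLaw_le x₀ P hM hτ0.le hτ1 hdet hχtop ?_
    refine le_trans (le_of_eq ?_) (LPD.exp_four_mul_xi_sq_le hdet)
    congr 1
    rw [hτ, div_pow, Real.sq_sqrt (by positivity)]
    field_simp
    ring
  · rw [ge_iff_le, hR ρ h0, Real.le_logb_iff_rpow_le one_lt_two (by exact_mod_cast hM)]
    exact hspec ρ h0 h1
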